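/- Let $S$ be a standard Borel space, let $\mathcal N_S$ be the space of finite counting measures on $S$ (finite sums of Dirac masses) and, for a measure $\nu$ on $S$ and a bounded measurable $f:S\to\mathbb R$, write $\nu(f)=\int f\,\mathrm d\nu$; for a finite $\nu\neq 0$ write $\bar\nu=\nu(\mathbf 1)^{-1}\nu$. Let $(P_s)_{s\in S}$ be a measurable kernel of probability distributions on $\{-1,0,1,2,\ldots\}\times\mathcal N_S$; under $P_s$ the canonical pair is denoted $(C,\xi)$ and expectation is denoted $E_s$. Assume $P_s(C+\xi(\mathbf 1)\ge 0)=1$ for all $s\in S$. The urn scheme is a sequence $(U_n)_{n\ge 0}$ of random elements of $\mathcal N_S$ with $U_0\neq 0$ almost surely, constructed as follows. For every $n\ge 0$, conditionally on $U_0,\ldots,U_n$, a color $\sigma_n$ is sampled with law $\bar U_n$; then, conditionally on $U_0,\ldots,U_n$ and $\sigma_n=s$, a pair $(C_{n+1},\xi_{n+1})$ is sampled with law $P_s$, and $$U_{n+1}=U_n+C_{n+1}\delta_{\sigma_n}+\xi_{n+1}.$$ Assume the following. (2) The function $s\mapsto E_s(C)$ is constant on $S$. (3) There are a finite non-zero measure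 $\mu$ on $S$ and a measurable function $a:S\to\mathbb R$ with $0<\inf_S a\le\sup_S a<\infty$ such that $E_s(\xi(f))=a(s)\mu(f)$ for every $s\in S$ and every bounded measurable $f:S\to\mathbb R$. (4) $\inf_{s\in S}P_s(C+\xi(\mathbf 1)\ge 1)>0$ and $\sup_{s\in S}E_s\big((C+\xi(\mathbf 1))^2\big)<\infty$. Let $\lambda_1=E_s(C)+\mu(a)$, which does not depend on $s$. Then for every bounded measurable $f:S\to\mathbb R$, $$\lim_{n\to\infty}n^{-1}U_n(f)=\lambda_1\,\bar\mu(f)\qquad\text{almost surely},$$ and consequently $$\lim_{n\to\infty}\bar U_n(f)=\bar\mu(f)\qquad\text{almost surely}.$$ -/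

import Mathlib

open MeasureTheory ProbabilityTheory Filter Topology

/-- Finite counting measures on `S`: the finite sums of Dirac masses `δ_{s₁} + ⋯ + δ_{s_j}`
(the points need not be distinct, and the sum may be empty).  This type carries the σ-field
induced by Mathlib's σ-field on `Measure S`, which is generated by the evaluations `ν ↦ ν B`. -/
abbrev CountingMeasure (S : Type*) [MeasurableSpace S] : Type _ :=
  {ν : Measure S // ∃ l : Multiset S, ν = (l.map Measure.dirac).sum}

/-- The set `{-1, 0, 1, 2, …}` of possible numbers of copies. -/
abbrev Copies : Type := {k : ℤ // -1 ≤ k}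

/-- A replacement: the pair `(C, ξ)` of a number of copies and a family of new balls. -/
abbrev Replacement (S : Type*) [MeasurableSpace S] : Type _ := Copies × CountingMeasure S

/-- The normalized measure `ν(1)⁻¹ ν`. -/
noncomputable def normalized {S : Type*} [MeasurableSpace S] (ν : Measure S) : Measure S :=
  (ν Set.univ)⁻¹ • ν

/-- The number `C`, as a real number. -/
def Replacement.copies {S : Type*} [MeasurableSpace S] (r : Replacement S) : ℝ := (r.1.1 : ℝ)

/-- The integral `ξ(f)` of `f` with respect to the innovation `ξ`. -/
noncomputable def Replacement.innov {S : Type*} [MeasurableSpace S] (r : Replacement S)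
    (f : S → ℝ) : ℝ := ∫ s, f s ∂r.2.1

/-- The net number `C + ξ(1)` of balls added to the urn. -/
noncomputable def Replacement.net {S : Type*} [MeasurableSpace S] (r : Replacement S) : ℝ :=
  r.copies + r.innov (fun _ => 1)

/-- The space `𝓛^∞` of bounded measurable functions. -/
def BoundedMeasurable {S : Type*} [MeasurableSpace S] (f : S → ℝ) : Prop :=
  Measurable f ∧ ∃ K : ℝ, ∀ s, |f s| ≤ K

/-- The σ-field generated by `U₀, …, U_n`. -/
abbrev urnHistory {Ω S : Type*} [MeasurableSpace S] (U : ℕ → Ω → CountingMeasure S) (n : ℕ) :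
    MeasurableSpace Ω :=
  MeasurableSpace.comap (fun ω (k : Fin (n + 1)) => U k ω) inferInstance

/-- The σ-field generated by `U₀, …, U_n` and the sampled color `σ_n`. -/
abbrev sampledHistory {Ω S : Type*} [MeasurableSpace S] (U : ℕ → Ω → CountingMeasure S)
    (σ : ℕ → Ω → S) (n : ℕ) : MeasurableSpace Ω :=
  urnHistory U n ⊔ MeasurableSpace.comap (σ n) inferInstance

/-- `U` is the urn scheme with replacement kernel `P`, sampled colors `σ₀, σ₁, …` and replacements
`R₁, R₂, …`, `R_{n+1} = (C_{n+1}, ξ_{n+1})`, under the probability measure `Pr`. -/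
structure IsUrnScheme {Ω S : Type*} [MeasurableSpace Ω] [MeasurableSpace S]
    (P : Kernel S (Replacement S)) (Pr : Measure Ω) (U : ℕ → Ω → CountingMeasure S)
    (σ : ℕ → Ω → S) (R : ℕ → Ω → Replacement S) : Prop where
  measurable_urn : ∀ n, Measurable (U n)
  measurable_color : ∀ n, Measurable (σ n)
  measurable_replacement : ∀ n, Measurable (R (n + 1))
  /-- The urn is initially nonempty. -/
  init : ∀ᵐ ω ∂Pr, (U 0 ω).1 ≠ 0
  /-- Given `U₀, …, U_n`, the color `σ_n` has the empirical distribution of `U_n` as its law. -/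
  color_law : ∀ n, ∀ B : Set S, MeasurableSet B →
    Pr⟦σ n ⁻¹' B | urnHistory U n⟧ =ᵐ[Pr] fun ω => (normalized (U n ω).1).real B
  /-- Given `U₀, …, U_n` and `σ_n = s`, the pair `(C_{n+1}, ξ_{n+1})` has law `P_s`. -/
  replacement_law : ∀ n, ∀ D : Set (Replacement S), MeasurableSet D →
    Pr⟦R (n + 1) ⁻¹' D | sampledHistory U σ n⟧ =ᵐ[Pr] fun ω => (P (σ n ω)).real D
  /-- `U_{n+1} = U_n + C_{n+1} δ_{σ_n} + ξ_{n+1}`, with `δ_{σ_n}` added on both sides since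
  `C_{n+1}` may be `-1`. -/
  step : ∀ n, ∀ᵐ ω ∂Pr,
    (U (n + 1) ω).1 + Measure.dirac (σ n ω) =
      (U n ω).1 + ((R (n + 1) ω).1.1 + 1).toNat • Measure.dirac (σ n ω) + (R (n + 1) ω).2.1

/-! Write λ₂ = E_s(C). Given the history, the mean increment of U_n(f) is the integral of λ₂ f +
μ(f) a against the normalized urn, and the remaining noise averages out almost surely
(`ae_tendsto_average_noise`). If μ(f) = 0, the drift is λ₂ U_n(f) / U_n(1), so D_n = U_n(f)
satisfies a scalar recursion with growth rate λ₂ / U_n(1).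

The total U_n(1) grows at least like r n for some r > max(λ₂, 0), because its conditional drift is
an average of λ₂ + a(s) μ(1). Hence D_n grows with exponent less than 1, and D_n / n → 0
(`tendsto_div_zero_of_subcritical`). Centering an arbitrary f by μ(f)/μ(1) gives U_n(f) =
(μ(f)/μ(1)) U_n(1) + o(n).

Applied to f = a, this makes the drift of U_n(1) converge to λ₂ + μ(a) = λ₁, so U_n(1)/n → λ₁. Both
limits follow. -/

/-! ### Deterministic averages and recursions -/

/-- **Kronecker's lemma** for the weights `n + 1`. -/
lemma tendsto_average_zero_of_tendsto_weighted_sum {x : ℕ → ℝ} {L : ℝ}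
    (h : Tendsto (fun n => ∑ k ∈ Finset.range n, x k / (k + 1)) atTop (𝓝 L)) :
    Tendsto (fun n : ℕ => (n : ℝ)⁻¹ * ∑ k ∈ Finset.range n, x k) atTop (𝓝 0) := by
  set N : ℕ → ℝ := fun n => ∑ k ∈ Finset.range n, x k / (k + 1) with hN
  -- Summation by parts; after division by n, both terms tend to L, the second by Cesàro.
  have key : ∀ n : ℕ, ∑ k ∈ Finset.range n, x k = n * N n - ∑ k ∈ Finset.range n, N k := by
    intro n
    induction n with
    | zero => simp
    | succ n ih =>
      have h1 : N (n + 1) = N n + x n / (n + 1) := Finset.sum_range_succ _ _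
      have hn : (n : ℝ) + 1 ≠ 0 := by positivity
      rw [Finset.sum_range_succ, Finset.sum_range_succ, ih, h1]
      push_cast
      field_simp
      ring
  have h2 : Tendsto (fun n : ℕ => N n - (n : ℝ)⁻¹ * ∑ k ∈ Finset.range n, N k) atTop (𝓝 (L - L)) :=
    h.sub h.cesaro
  rw [sub_self] at h2
  refine h2.congr' ?_
  filter_upwards [eventually_gt_atTop 0] with n hn
  have : (n : ℝ) ≠ 0 := by positivity
  rw [key]
  field_simp

/-- The positive part of x - ε/2 eventually shrinks by a factor 1 - β ≤ exp(-β) at each step, and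
the product of these factors vanishes because the sum of the β diverges. -/
lemma tendsto_zero_of_contraction {x β δ : ℕ → ℝ} (hx : ∀ n, 0 ≤ x n)
    (hβ : ∀ᶠ n in atTop, 0 ≤ β n ∧ β n ≤ 1)
    (hsum : Tendsto (fun n => ∑ k ∈ Finset.range n, β k) atTop atTop)
    (hδ : Tendsto δ atTop (𝓝 0))
    (hrec : ∀ᶠ n in atTop, x (n + 1) ≤ (1 - β n) * x n + β n * δ n) :
    Tendsto x atTop (𝓝 0) := by
  have main : ∀ ε > 0, ∀ᶠ n in atTop, x n < ε := by
    intro ε hε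
    have hδ' : ∀ᶠ n in atTop, δ n < ε / 2 := hδ.eventually_lt_const (by positivity)
    obtain ⟨N, hN⟩ := eventually_atTop.1 (hβ.and (hδ'.and hrec))
    set B : ℕ → ℝ := fun n => ∑ k ∈ Finset.range n, β k with hB
    set y : ℕ → ℝ := fun n => max (x n - ε / 2) 0 with hy
    have hy0 : ∀ n, 0 ≤ y n := fun n => le_max_right _ _
    have step : ∀ n, N ≤ n → y n ≤ y N * Real.exp (B N - B n) := by
      intro n hn
      induction n, hn using Nat.le_induction with
      | base => simp
      | succ n hn ih =>
        obtain ⟨⟨hb0, hb1⟩, hd, hr⟩ := hN n hn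
        have hBs : B (n + 1) = B n + β n := Finset.sum_range_succ _ _
        have h1 : y (n + 1) ≤ (1 - β n) * y n := by
          refine max_le ?_ (mul_nonneg (by linarith) (hy0 n))
          have : x n - ε / 2 ≤ y n := le_max_left _ _
          nlinarith [mul_le_mul_of_nonneg_left this (sub_nonneg.2 hb1),
            mul_le_mul_of_nonneg_left hd.le hb0]
        have h2 : 1 - β n ≤ Real.exp (-β n) := by
          have := Real.add_one_le_exp (-β n); linarith
        calc y (n + 1) ≤ Real.exp (-β n) * y n := h1.trans (mul_le_mul_of_nonneg_right h2 (hy0 n))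
          _ ≤ Real.exp (-β n) * (y N * Real.exp (B N - B n)) := by gcongr
          _ = y N * Real.exp (B N - B (n + 1)) := by
            rw [hBs, show B N - (B n + β n) = -β n + (B N - B n) by ring, Real.exp_add]; ring
    have hlim : Tendsto (fun n => y N * Real.exp (B N - B n)) atTop (𝓝 (y N * 0)) :=
      (Real.tendsto_exp_atBot.comp (tendsto_const_nhds.add_atBot
        (tendsto_neg_atTop_atBot.comp hsum))).const_mul _
    rw [mul_zero] at hlim
    filter_upwards [hlim.eventually_lt_const (half_pos hε), eventually_ge_atTop N] with n h1 h2
    have := (le_max_left (x n - ε / 2) 0).trans_lt ((step n h2).trans_lt h1)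
    linarith
  rw [Metric.tendsto_nhds]
  intro ε hε
  filter_upwards [main ε hε] with n hn
  rwa [Real.dist_eq, sub_zero, abs_of_nonneg (hx n)]

lemma tendsto_sum_const_div_add_one_atTop {c : ℝ} (hc : 0 < c) :
    Tendsto (fun n => ∑ k ∈ Finset.range n, c / ((k : ℝ) + 1)) atTop atTop := by
  have h := Real.tendsto_sum_range_one_div_nat_succ_atTop.const_mul_atTop hc
  refine h.congr fun n => ?_
  rw [Finset.mul_sum]
  exact Finset.sum_congr rfl fun k _ => by ring

/-- A sequence with relative growth rate `l / T n`, where `T` grows at a linear rate greater than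
`l`, is sublinear, if the perturbations average out. -/
lemma tendsto_div_zero_of_subcritical {D T e : ℕ → ℝ} {l r : ℝ} (hl : -1 ≤ l) (hr : 0 < r)
    (hlr : l < r) (hT1 : ∀ n, 1 ≤ T n) (hT : ∀ᶠ n : ℕ in atTop, r * n ≤ T n)
    (hD : ∀ n, D (n + 1) = D n + l * (D n / T n) + e n)
    (he : Tendsto (fun n : ℕ => (n : ℝ)⁻¹ * ∑ k ∈ Finset.range n, e k) atTop (𝓝 0)) :
    Tendsto (fun n : ℕ => (n : ℝ)⁻¹ * D n) atTop (𝓝 0) := by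
  set M : ℕ → ℝ := fun n => ∑ k ∈ Finset.range n, e k with hM
  -- Subtracting the accumulated noise M leaves a recursion perturbed only by l M/T, which is o(1).
  set G : ℕ → ℝ := fun n => D n - M n with hG
  have hMs : ∀ n, M (n + 1) = M n + e n := fun n => Finset.sum_range_succ _ _
  have hGs : ∀ n, G (n + 1) = (1 + l / T n) * G n + l * (M n / T n) := by
    intro n
    have : T n ≠ 0 := by linarith [hT1 n]
    simp only [hG, hD, hMs]
    field_simp
    ring
  -- θ bounds the growth exponent of |G|: since (n + θ)/(n + 1) = 1 - (1 - θ)/(n + 1), the sequence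
  -- |G n|/n contracts with rate β.
  set θ : ℝ := max l 0 / r with hθ
  have hθ0 : 0 ≤ θ := by positivity
  have hθ1 : θ < 1 := by rw [hθ, div_lt_one hr]; exact max_lt hlr hr
  set β : ℕ → ℝ := fun n => (1 - θ) / ((n : ℝ) + 1) with hβ
  set δ : ℕ → ℝ := fun n => |l| / (r * (1 - θ)) * |(n : ℝ)⁻¹ * M n| with hδ
  have hx : Tendsto (fun n : ℕ => (n : ℝ)⁻¹ * |G n|) atTop (𝓝 0) := by
    refine tendsto_zero_of_contraction (β := β) (δ := δ) (fun n => by positivity) ?_ ?_ ?_ ?_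
    · refine Eventually.of_forall fun n => ⟨div_nonneg (by linarith) (by positivity), ?_⟩
      rw [hβ, div_le_one (by positivity)]
      have : (0 : ℝ) ≤ n := by positivity
      linarith
    · exact tendsto_sum_const_div_add_one_atTop (by linarith)
    · have := he.abs.const_mul (|l| / (r * (1 - θ)))
      rwa [abs_zero, mul_zero] at this
    · filter_upwards [hT, eventually_gt_atTop 0] with n hn hn0
      have hn0' : (0 : ℝ) < n := by exact_mod_cast hn0
      have hTn := hT1 n
      have hTp : 0 < T n := by linarith
      have hrn : 0 < r * n := by positivity
      have h1θ : 0 < 1 - θ := by linarith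
      -- Here -1 ≤ l and 1 ≤ T n keep the factor nonnegative, so it passes through absolute values.
      have h0 : 0 ≤ 1 + l / T n := by
        have : -1 ≤ l / T n := by rw [le_div_iff₀ hTp]; nlinarith
        linarith
      have h1 : 1 + l / T n ≤ 1 + θ / n := by
        have : l / T n ≤ max l 0 / (r * n) :=
          (div_le_div_of_nonneg_right (le_max_left l 0) hTp.le).trans
            (div_le_div_of_nonneg_left (le_max_right _ _) hrn hn)
        rw [hθ, div_div]
        linarith
      have h2 : |l * (M n / T n)| ≤ |l| * (|M n| / (r * n)) := by
        rw [abs_mul, abs_div, abs_of_pos hTp]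
        gcongr
      have h3 : |G (n + 1)| ≤ (1 + θ / n) * |G n| + |l| * (|M n| / (r * n)) := by
        rw [hGs]
        refine (abs_add_le _ _).trans (add_le_add ?_ h2)
        rw [abs_mul, abs_of_nonneg h0]
        gcongr
      calc ((n + 1 : ℕ) : ℝ)⁻¹ * |G (n + 1)|
          ≤ ((n + 1 : ℕ) : ℝ)⁻¹ * ((1 + θ / n) * |G n| + |l| * (|M n| / (r * n))) := by gcongr
        _ = (1 - β n) * ((n : ℝ)⁻¹ * |G n|) + β n * δ n := by
          simp only [hβ, hδ, abs_mul, abs_inv, Nat.abs_cast]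
          push_cast
          field_simp
          ring
  have hx' : Tendsto (fun n : ℕ => (n : ℝ)⁻¹ * G n) atTop (𝓝 0) := by
    rw [tendsto_zero_iff_abs_tendsto_zero]
    refine hx.congr fun n => ?_
    simp [abs_mul]
  have := hx'.add he
  rw [add_zero] at this
  refine this.congr fun n => ?_
  simp only [hG]
  ring

/-! ### Martingale strong law -/

/-- **Strong law of large numbers** for martingale differences bounded in `L²`. -/
lemma ae_tendsto_average_of_martingale_difference {Ω : Type*} {mΩ : MeasurableSpace Ω}
    {Pr : Measure Ω} [IsProbabilityMeasure Pr] {ℱ : Filtration ℕ mΩ} {e : ℕ → Ω → ℝ} {B : ℝ}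
    (hadp : ∀ n, StronglyMeasurable[ℱ (n + 1)] (e n)) (hL2 : ∀ n, MemLp (e n) 2 Pr)
    (hB : ∀ n, ∫ ω, e n ω ^ 2 ∂Pr ≤ B) (hzero : ∀ n, Pr[e n | ℱ n] =ᵐ[Pr] 0) :
    ∀ᵐ ω ∂Pr, Tendsto (fun n : ℕ => (n : ℝ)⁻¹ * ∑ k ∈ Finset.range n, e k ω) atTop (𝓝 0) := by
  -- The weights 1/(k + 1) are square summable, so orthogonality of increments bounds this
  -- martingale in L², hence in L¹. It converges almost surely, and Kronecker's lemma concludes.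
  set N : ℕ → Ω → ℝ := fun n ω => ∑ k ∈ Finset.range n, e k ω / (k + 1) with hN
  have hNs : ∀ n, N (n + 1) = N n + ((n : ℝ) + 1)⁻¹ • e n := by
    intro n; ext ω
    simp [hN, Finset.sum_range_succ, div_eq_inv_mul]
  have hNmeas : ∀ n, StronglyMeasurable[ℱ n] (N n) := by
    intro n
    induction n with
    | zero => simpa [hN] using stronglyMeasurable_const
    | succ n ih =>
      rw [hNs]
      exact (ih.mono (ℱ.mono n.le_succ)).add ((hadp n).const_smul _)
  have hNL2 : ∀ n, MemLp (N n) 2 Pr := by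
    intro n
    induction n with
    | zero => simp [hN]
    | succ n ih => rw [hNs]; exact ih.add ((hL2 n).const_smul _)
  have hint : ∀ n, Integrable (N n) Pr := fun n => (hNL2 n).integrable one_le_two
  have heint : ∀ n, Integrable (e n) Pr := fun n => (hL2 n).integrable one_le_two
  have hmart : Martingale N ℱ Pr := by
    refine martingale_nat hNmeas hint fun n => ?_
    rw [hNs]
    refine EventuallyEq.symm ((condExp_add (hint n) ((heint n).smul _) _).trans ?_)
    rw [condExp_of_stronglyMeasurable (ℱ.le n) (hNmeas n) (hint n)]
    filter_upwards [condExp_smul (μ := Pr) ((n : ℝ) + 1)⁻¹ (e n) (ℱ n), hzero n] with ω h1 h2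
    simp [h1, h2]
  have horth : ∀ n, ∫ ω, N n ω * e n ω ∂Pr = 0 := by
    intro n
    have hi : Integrable (N n * e n) Pr := (hNL2 n).integrable_mul (hL2 n)
    have h1 := condExp_mul_of_stronglyMeasurable_left (hNmeas n) hi (heint n)
    have h2 : ∫ ω, (Pr[N n * e n | ℱ n]) ω ∂Pr = ∫ ω, (N n * e n) ω ∂Pr := integral_condExp (ℱ.le n)
    change ∫ ω, (N n * e n) ω ∂Pr = 0
    rw [← h2]
    refine (integral_congr_ae (g := fun _ => 0) ?_).trans (by simp)
    filter_upwards [h1, hzero n] with ω h3 h4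
    simp [h3, h4]
  have hsq : ∀ n, ∫ ω, N n ω ^ 2 ∂Pr ≤ ∑ k ∈ Finset.range n, B * (1 / ((k : ℝ) + 1) ^ 2) := by
    intro n
    induction n with
    | zero => simp [hN]
    | succ n ih =>
      have h1 : (fun ω => N (n + 1) ω ^ 2) = fun ω => N n ω ^ 2 +
          (2 * ((n : ℝ) + 1)⁻¹ * (N n ω * e n ω) + 1 / ((n : ℝ) + 1) ^ 2 * e n ω ^ 2) := by
        ext ω
        rw [hNs]
        simp only [Pi.add_apply, Pi.smul_apply, smul_eq_mul]
        field_simp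
        ring
      have hi : Integrable (fun ω => N n ω * e n ω) Pr := (hNL2 n).integrable_mul (hL2 n)
      have hi1 := hi.const_mul (2 * ((n : ℝ) + 1)⁻¹)
      have hi2 := (hL2 n).integrable_sq.const_mul (1 / ((n : ℝ) + 1) ^ 2)
      have hi3 : Integrable (fun ω => 2 * ((n : ℝ) + 1)⁻¹ * (N n ω * e n ω) +
          1 / ((n : ℝ) + 1) ^ 2 * e n ω ^ 2) Pr := hi1.add hi2
      rw [h1, integral_add (hNL2 n).integrable_sq hi3, integral_add hi1 hi2, integral_const_mul,
        integral_const_mul, horth, Finset.sum_range_succ]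
      have : 1 / ((n : ℝ) + 1) ^ 2 * ∫ ω, e n ω ^ 2 ∂Pr ≤ B * (1 / ((n : ℝ) + 1) ^ 2) := by
        rw [mul_comm B]
        exact mul_le_mul_of_nonneg_left (hB n) (by positivity)
      linarith
  have hB0 : 0 ≤ B := (integral_nonneg fun ω => sq_nonneg _).trans (hB 0)
  have hs : Summable fun k : ℕ => B * (1 / ((k : ℝ) + 1) ^ 2) := by
    refine Summable.mul_left _ ?_
    have := (summable_nat_add_iff 1).2 (Real.summable_one_div_nat_pow.2 one_lt_two)
    simpa using this
  set K : ℝ := ∑' k : ℕ, B * (1 / ((k : ℝ) + 1) ^ 2) with hK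
  have hbdd : ∀ n, eLpNorm (N n) 1 Pr ≤ ((K + 1).toNNReal : ENNReal) := by
    intro n
    rw [eLpNorm_one_eq_lintegral_enorm, ← ofReal_integral_norm_eq_lintegral_enorm (hint n)]
    refine ENNReal.ofReal_le_ofReal ?_
    have h1 : ∫ ω, N n ω ^ 2 ∂Pr ≤ K :=
      (hsq n).trans (hs.sum_le_tsum _ fun k _ => by positivity)
    calc ∫ ω, ‖N n ω‖ ∂Pr ≤ ∫ ω, (N n ω ^ 2 + 1) ∂Pr := by
          refine integral_mono (hint n).norm ((hNL2 n).integrable_sq.add (integrable_const _)) ?_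
          intro ω
          simp only [Real.norm_eq_abs]
          nlinarith [sq_abs (N n ω), sq_nonneg (|N n ω| - 1), abs_nonneg (N n ω)]
      _ = ∫ ω, N n ω ^ 2 ∂Pr + 1 := by
          rw [integral_add (hNL2 n).integrable_sq (integrable_const _)]; simp
      _ ≤ K + 1 := by linarith
  filter_upwards [hmart.submartingale.exists_ae_tendsto_of_bdd hbdd] with ω ⟨c, hc⟩
  exact tendsto_average_zero_of_tendsto_weighted_sum hc

/-! ### From conditional probabilities of events to conditional expectations -/

section ConditionalLaw

variable {Ω E : Type*} {m mΩ : MeasurableSpace Ω} [MeasurableSpace E] {Pr : Measure Ω}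
  [IsProbabilityMeasure Pr] {X : Ω → E} {κ : Ω → Measure E}

/-- Integrating the conditional probabilities over A gives an identity of measures, from which
integrals of general functions follow. Mass at most 1 is allowed because `normalized` sends the zero
measure to zero. -/
lemma map_restrict_eq_bind_of_condLaw (hm : m ≤ mΩ) (hX : Measurable[mΩ] X)
    (hκ : Measurable[m] κ) (hκ1 : ∀ ω, κ ω Set.univ ≤ 1)
    (hlaw : ∀ D : Set E, MeasurableSet D → Pr⟦X ⁻¹' D | m⟧ =ᵐ[Pr] fun ω => (κ ω).real D)
    {A : Set Ω} (hA : MeasurableSet[m] A) :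
    (Pr.restrict A).map X = (Pr.restrict A).bind κ := by
  ext D hD
  have hκD : Measurable fun ω => κ ω D := (Measure.measurable_coe hD).comp (hκ.mono hm le_rfl)
  have hle : ∀ ω, κ ω D ≤ 1 := fun ω => (measure_mono (Set.subset_univ _)).trans (hκ1 ω)
  have hXD : MeasurableSet[mΩ] (X ⁻¹' D) := hX hD
  rw [Measure.map_apply hX hD, Measure.bind_apply hD (hκ.mono hm le_rfl).aemeasurable]
  have h1 : ∫ ω in A, (Pr⟦X ⁻¹' D | m⟧) ω ∂Pr =
      ∫ ω in A, (X ⁻¹' D).indicator (fun _ => (1 : ℝ)) ω ∂Pr :=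
    setIntegral_condExp hm ((integrable_const _).indicator hXD) hA
  rw [integral_congr_ae (ae_restrict_of_ae (hlaw D hD)), integral_indicator hXD] at h1
  simp only [Measure.real, integral_const, smul_eq_mul, mul_one] at h1
  rw [integral_toReal hκD.aemeasurable
    (ae_of_all _ fun ω => (hle ω).trans_lt ENNReal.one_lt_top)] at h1
  have hfin : ∫⁻ ω in A, κ ω D ∂Pr ≠ ⊤ := by
    refine ne_top_of_le_ne_top (b := ∫⁻ ω in A, 1 ∂Pr) ?_ (lintegral_mono hle)
    simp
  rw [ENNReal.toReal_eq_toReal_iff' hfin (by simp)] at h1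
  rw [h1]
  simp

lemma lintegral_comp_of_condLaw (hm : m ≤ mΩ) (hX : Measurable[mΩ] X)
    (hκ : Measurable[m] κ) (hκ1 : ∀ ω, κ ω Set.univ ≤ 1)
    (hlaw : ∀ D : Set E, MeasurableSet D → Pr⟦X ⁻¹' D | m⟧ =ᵐ[Pr] fun ω => (κ ω).real D)
    {h : E → ENNReal} (hh : Measurable h) :
    ∫⁻ ω, h (X ω) ∂Pr = ∫⁻ ω, ∫⁻ x, h x ∂(κ ω) ∂Pr := by
  have := map_restrict_eq_bind_of_condLaw hm hX hκ hκ1 hlaw (A := Set.univ) MeasurableSet.univ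
  rw [Measure.restrict_univ] at this
  rw [← lintegral_map hh hX, this, Measure.lintegral_bind (hκ.mono hm le_rfl).aemeasurable
    hh.aemeasurable]

lemma condExp_comp_of_condLaw (hm : m ≤ mΩ) (hX : Measurable[mΩ] X)
    (hκ : Measurable[m] κ) (hκ1 : ∀ ω, κ ω Set.univ ≤ 1)
    (hlaw : ∀ D : Set E, MeasurableSet D → Pr⟦X ⁻¹' D | m⟧ =ᵐ[Pr] fun ω => (κ ω).real D)
    {h : E → ℝ} (hh : Measurable h) (hint : Integrable (fun ω => h (X ω)) Pr) :
    Pr[fun ω => h (X ω) | m] =ᵐ[Pr] fun ω => ∫ x, h x ∂(κ ω) := by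
  let η : Kernel Ω E := ⟨κ, hκ.mono hm le_rfl⟩
  have hmap : ∀ A, MeasurableSet[m] A →
      (Pr.restrict A).map X = (η ∘ₖ Kernel.const Unit (Pr.restrict A)) () := by
    intro A hA
    rw [map_restrict_eq_bind_of_condLaw hm hX hκ hκ1 hlaw hA, Kernel.comp_apply,
      Kernel.const_apply]
    rfl
  have hintA : ∀ A, MeasurableSet[m] A →
      Integrable h ((η ∘ₖ Kernel.const Unit (Pr.restrict A)) ()) := by
    intro A hA
    rw [← hmap A hA, integrable_map_measure hh.aestronglyMeasurable hX.aemeasurable]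
    exact hint.restrict
  have hiA : ∀ A, MeasurableSet[m] A → IntegrableOn (fun ω => ∫ x, h x ∂(κ ω)) A Pr := by
    intro A hA
    exact (hintA A hA).integral_comp
  refine (ae_eq_condExp_of_forall_setIntegral_eq hm hint (fun A hA _ => hiA A hA) ?_ ?_).symm
  · intro A hA _
    rw [← integral_map (f := h) hX.aemeasurable hh.aestronglyMeasurable, hmap A hA,
      Kernel.integral_comp (hintA A hA)]
    rfl
  -- The same kernel as `η`, now over the smaller σ-field `m`, to obtain `m`-measurability of the
  -- integral.
  · let η' : @Kernel Ω E m _ := @Kernel.mk Ω E m _ κ hκ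
    exact (StronglyMeasurable.integral_kernel (mα := m) (κ := η')
      hh.stronglyMeasurable).aestronglyMeasurable

end ConditionalLaw

/-! ### Finite counting measures and normalization -/

section CountingMeasures

variable {S : Type*} [MeasurableSpace S]

lemma CountingMeasure.exists_measure_univ_eq_natCast (ν : CountingMeasure S) :
    ∃ k : ℕ, ν.1 Set.univ = k := by
  obtain ⟨ν, l, rfl⟩ := ν
  refine ⟨Multiset.card l, ?_⟩
  induction l using Multiset.induction_on with
  | empty => simp
  | cons x l ih =>
    simp only [Multiset.map_cons, Multiset.sum_cons, Measure.add_apply, ih, Multiset.card_cons]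
    simp [add_comm]

instance CountingMeasure.isFiniteMeasure (ν : CountingMeasure S) : IsFiniteMeasure ν.1 := by
  obtain ⟨k, hk⟩ := ν.exists_measure_univ_eq_natCast
  exact ⟨by simp [hk]⟩

lemma CountingMeasure.one_le_integral_one {ν : CountingMeasure S} (h : ν.1 ≠ 0) :
    1 ≤ ∫ _, (1 : ℝ) ∂ν.1 := by
  obtain ⟨k, hk⟩ := ν.exists_measure_univ_eq_natCast
  have hk0 : k ≠ 0 := by
    rintro rfl
    exact h (Measure.measure_univ_eq_zero.1 (by simpa using hk))
  simp only [integral_const, Measure.real, hk, ENNReal.toReal_natCast, smul_eq_mul, mul_one]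
  exact_mod_cast Nat.one_le_iff_ne_zero.2 hk0

lemma CountingMeasure.measurable_integral {f : S → ℝ} (hf : Measurable f) :
    Measurable fun ν : CountingMeasure S => ∫ s, f s ∂ν.1 := by
  let η : Kernel (CountingMeasure S) S := ⟨Subtype.val, measurable_subtype_coe⟩
  exact (StronglyMeasurable.integral_kernel (κ := η) hf.stronglyMeasurable).measurable

lemma BoundedMeasurable.integrable {f : S → ℝ} (hf : BoundedMeasurable f) (ν : Measure S)
    [IsFiniteMeasure ν] : Integrable f ν := by
  obtain ⟨hm, K, hK⟩ := hf
  exact Integrable.of_bound hm.aestronglyMeasurable K (ae_of_all _ hK)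

lemma boundedMeasurable_const (c : ℝ) : BoundedMeasurable fun _ : S => c :=
  ⟨measurable_const, |c|, fun _ => le_rfl⟩

lemma BoundedMeasurable.linear_combination {f g : S → ℝ} (hf : BoundedMeasurable f)
    (hg : BoundedMeasurable g) (c d : ℝ) : BoundedMeasurable fun s => c * f s + d * g s := by
  obtain ⟨hfm, K, hK⟩ := hf
  obtain ⟨hgm, L, hL⟩ := hg
  refine ⟨(hfm.const_mul c).add (hgm.const_mul d), |c| * K + |d| * L, fun s => ?_⟩
  refine (abs_add_le _ _).trans ?_
  rw [abs_mul, abs_mul]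
  exact add_le_add (mul_le_mul_of_nonneg_left (hK s) (abs_nonneg c))
    (mul_le_mul_of_nonneg_left (hL s) (abs_nonneg d))

lemma integral_normalized (ν : Measure S) (f : S → ℝ) :
    ∫ s, f s ∂(normalized ν) = (∫ s, f s ∂ν) / ∫ _, (1 : ℝ) ∂ν := by
  simp [normalized, integral_smul_measure, Measure.real, div_eq_inv_mul]

lemma normalized_univ_le_one (ν : Measure S) : normalized ν Set.univ ≤ 1 := by
  simp only [normalized, Measure.smul_apply, smul_eq_mul]
  exact ENNReal.inv_mul_le_one _

lemma measurable_normalized : Measurable fun ν : Measure S => normalized ν := by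
  refine Measure.measurable_of_measurable_coe _ fun B hB => ?_
  simp only [normalized, Measure.smul_apply, smul_eq_mul]
  exact (Measure.measurable_coe MeasurableSet.univ).inv.mul (Measure.measurable_coe hB)

instance isFiniteMeasure_normalized (ν : Measure S) : IsFiniteMeasure (normalized ν) :=
  ⟨(normalized_univ_le_one ν).trans_lt ENNReal.one_lt_top⟩

end CountingMeasures

/-! ### Moment bounds for replacements -/

section Replacements

variable {S : Type*} [MeasurableSpace S]

lemma Replacement.measurable_copies : Measurable (Replacement.copies (S := S)) :=
  (measurable_from_top (f := fun k : ℤ => (k : ℝ))).comp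
    (measurable_subtype_coe.comp measurable_fst)

lemma Replacement.measurable_innov {f : S → ℝ} (hf : Measurable f) :
    Measurable fun r : Replacement S => r.innov f :=
  (CountingMeasure.measurable_integral hf).comp measurable_snd

lemma Replacement.measurable_net : Measurable (Replacement.net (S := S)) :=
  Replacement.measurable_copies.add (Replacement.measurable_innov measurable_const)

lemma Replacement.neg_one_le_copies (r : Replacement S) : -1 ≤ r.copies := by
  have := r.1.2
  unfold Replacement.copies
  exact_mod_cast this

lemma Replacement.innov_one_nonneg (r : Replacement S) : 0 ≤ r.innov fun _ => 1 :=
  integral_nonneg fun _ => zero_le_one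

/-- Since C ≥ -1 and ξ(1) ≥ 0, C lies between -1 and C + ξ(1). Thus the second moment of the net
increment controls C, and likewise ξ(f). -/
lemma Replacement.abs_copies_le (r : Replacement S) : |r.copies| ≤ |r.net| + 1 := by
  have h1 := r.neg_one_le_copies
  have h2 := r.innov_one_nonneg
  have h3 : r.copies ≤ r.net := by unfold Replacement.net; linarith
  refine abs_le.2 ⟨by linarith [abs_nonneg r.net], by linarith [le_abs_self r.net]⟩

lemma Replacement.abs_innov_le (r : Replacement S) {f : S → ℝ} {K : ℝ} (hK0 : 0 ≤ K)
    (hK : ∀ s, |f s| ≤ K) : |r.innov f| ≤ K * (|r.net| + 1) := by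
  have h1 : |r.innov f| ≤ K * r.innov fun _ => 1 := by
    have := norm_integral_le_of_norm_le_const (μ := r.2.1) (f := f) (ae_of_all _ hK)
    simpa [Replacement.innov] using this
  refine h1.trans (mul_le_mul_of_nonneg_left ?_ hK0)
  have h3 : (r.innov fun _ => 1) = r.net - r.copies := by unfold Replacement.net; ring
  linarith [r.neg_one_le_copies, le_abs_self r.net]

section Moments

variable {Ω : Type*} {mΩ : MeasurableSpace Ω} {Q : Measure Ω}
  {ρ : Ω → Replacement S}

lemma Replacement.memLp_net (hρ : Measurable ρ)
    (hsq : ∫⁻ ω, ENNReal.ofReal ((ρ ω).net ^ 2) ∂Q < ⊤) : MemLp (fun ω => (ρ ω).net) 2 Q := by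
  have hm : Measurable fun ω => (ρ ω).net := Replacement.measurable_net.comp hρ
  rw [memLp_two_iff_integrable_sq hm.aestronglyMeasurable]
  refine ⟨(hm.pow_const 2).aestronglyMeasurable, ?_⟩
  rwa [hasFiniteIntegral_iff_ofReal (ae_of_all _ fun ω => sq_nonneg _)]

lemma Replacement.memLp_copies [IsProbabilityMeasure Q] (hρ : Measurable ρ)
    (hsq : ∫⁻ ω, ENNReal.ofReal ((ρ ω).net ^ 2) ∂Q < ⊤) : MemLp (fun ω => (ρ ω).copies) 2 Q := by
  refine ((memLp_net hρ hsq).norm.add (memLp_const 1)).mono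
    (Replacement.measurable_copies.comp hρ).aestronglyMeasurable (ae_of_all _ fun ω => ?_)
  exact ((ρ ω).abs_copies_le).trans (le_abs_self _)

lemma Replacement.memLp_innov [IsProbabilityMeasure Q] (hρ : Measurable ρ)
    (hsq : ∫⁻ ω, ENNReal.ofReal ((ρ ω).net ^ 2) ∂Q < ⊤) {f : S → ℝ} (hf : BoundedMeasurable f) :
    MemLp (fun ω => (ρ ω).innov f) 2 Q := by
  obtain ⟨hfm, K, hK⟩ := hf
  refine (((memLp_net hρ hsq).norm.add (memLp_const 1)).const_mul |K|).mono
    ((Replacement.measurable_innov hfm).comp hρ).aestronglyMeasurable (ae_of_all _ fun ω => ?_)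
  exact ((ρ ω).abs_innov_le (abs_nonneg K) fun s => (hK s).trans (le_abs_self K)).trans
    (le_abs_self _)

end Moments

end Replacements

/-! ### The filtration of the urn -/

section Histories

variable {Ω S : Type*} [MeasurableSpace S] {U : ℕ → Ω → CountingMeasure S} {σ : ℕ → Ω → S}

lemma measurable_urn_urnHistory {k n : ℕ} (h : k ≤ n) : Measurable[urnHistory U n] (U k) := by
  have h1 : Measurable[urnHistory U n] fun ω (k : Fin (n + 1)) => U k ω := comap_measurable _
  exact (measurable_pi_apply (⟨k, Nat.lt_succ_of_le h⟩ : Fin (n + 1))).comp h1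

lemma urnHistory_le {m : MeasurableSpace Ω} {n : ℕ} (h : ∀ k ≤ n, Measurable[m] (U k)) :
    urnHistory U n ≤ m := by
  refine Measurable.comap_le ?_
  exact measurable_pi_lambda _ fun k => h k (Nat.lt_succ_iff.1 k.2)

/-- The filtration generated by the urn process. -/
def urnFiltration [mΩ : MeasurableSpace Ω] (hU : ∀ n, Measurable (U n)) : Filtration ℕ mΩ where
  seq := urnHistory U
  mono' _ _ hij := urnHistory_le fun _ hk => measurable_urn_urnHistory (hk.trans hij)
  le' _ := urnHistory_le fun k _ => hU k

lemma measurable_color_sampledHistory (n : ℕ) : Measurable[sampledHistory U σ n] (σ n) :=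
  (comap_measurable (σ n)).mono le_sup_right le_rfl

end Histories

/-! ### Increments of the urn: drift and noise -/

namespace IsUrnScheme

variable {Ω S : Type*} [mΩ : MeasurableSpace Ω] [MeasurableSpace S]
  {P : Kernel S (Replacement S)} {Pr : Measure Ω}
  {U : ℕ → Ω → CountingMeasure S} {σ : ℕ → Ω → S} {R : ℕ → Ω → Replacement S}

lemma urnHistory_le (hU : IsUrnScheme P Pr U σ R) (n : ℕ) : urnHistory U n ≤ mΩ :=
  _root_.urnHistory_le fun k _ => hU.measurable_urn k

lemma sampledHistory_le (hU : IsUrnScheme P Pr U σ R) (n : ℕ) : sampledHistory U σ n ≤ mΩ :=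
  sup_le (hU.urnHistory_le n) (hU.measurable_color n).comap_le

lemma integral_step (hU : IsUrnScheme P Pr U σ R) (n : ℕ) {f : S → ℝ} (hf : BoundedMeasurable f) :
    ∀ᵐ ω ∂Pr, ∫ s, f s ∂(U (n + 1) ω).1 - ∫ s, f s ∂(U n ω).1 =
      f (σ n ω) * (R (n + 1) ω).copies + (R (n + 1) ω).innov f := by
  filter_upwards [hU.step n] with ω h
  have h1 := congrArg (fun ν : Measure S => ∫ s, f s ∂ν) h
  have hd : Integrable f (((R (n + 1) ω).1.1 + 1).toNat • Measure.dirac (σ n ω)) := by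
    rw [← Nat.cast_smul_eq_nsmul ENNReal]
    exact (hf.integrable _).smul_measure (ENNReal.natCast_ne_top _)
  rw [integral_add_measure (hf.integrable _) (hf.integrable _),
    integral_add_measure ((hf.integrable _).add_measure hd) (hf.integrable _),
    integral_add_measure (hf.integrable _) hd, ← Nat.cast_smul_eq_nsmul ENNReal,
    integral_smul_measure, integral_dirac' _ _ hf.1.stronglyMeasurable] at h1
  -- The truncation in `toNat` is harmless because C + 1 ≥ 0.
  have h2 : ((((R (n + 1) ω).1.1 + 1).toNat : ℝ)) = (R (n + 1) ω).copies + 1 := by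
    have : (((R (n + 1) ω).1.1 + 1).toNat : ℤ) = (R (n + 1) ω).1.1 + 1 :=
      Int.toNat_of_nonneg (by have := (R (n + 1) ω).1.2; omega)
    unfold Replacement.copies
    exact_mod_cast this
  rw [ENNReal.toReal_natCast, h2, smul_eq_mul] at h1
  unfold Replacement.innov
  linarith

variable [IsProbabilityMeasure Pr]

lemma condExp_color (hU : IsUrnScheme P Pr U σ R) (n : ℕ) {h : S → ℝ} (hh : BoundedMeasurable h) :
    Pr[fun ω => h (σ n ω) | urnHistory U n] =ᵐ[Pr]
      fun ω => ∫ s, h s ∂(normalized (U n ω).1) := by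
  refine condExp_comp_of_condLaw (hU.urnHistory_le n) (hU.measurable_color n)
    (measurable_normalized.comp (measurable_subtype_coe.comp (measurable_urn_urnHistory le_rfl)))
    (fun _ => normalized_univ_le_one _) (hU.color_law n) hh.1 ?_
  obtain ⟨hm, K, hK⟩ := hh
  exact Integrable.of_bound (hm.comp (hU.measurable_color n)).aestronglyMeasurable K
    (ae_of_all _ fun ω => hK _)

variable [IsMarkovKernel P]

lemma lintegral_replacement (hU : IsUrnScheme P Pr U σ R) (n : ℕ) {h : Replacement S → ENNReal}
    (hh : Measurable h) :
    ∫⁻ ω, h (R (n + 1) ω) ∂Pr = ∫⁻ ω, ∫⁻ r, h r ∂(P (σ n ω)) ∂Pr :=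
  lintegral_comp_of_condLaw (hU.sampledHistory_le n) (hU.measurable_replacement n)
    (P.measurable.comp (measurable_color_sampledHistory n))
    (fun ω => (prob_le_one : P (σ n ω) Set.univ ≤ 1))
    (hU.replacement_law n) hh

lemma condExp_replacement (hU : IsUrnScheme P Pr U σ R) (n : ℕ) {h : Replacement S → ℝ}
    (hh : Measurable h) (hint : Integrable (fun ω => h (R (n + 1) ω)) Pr) :
    Pr[fun ω => h (R (n + 1) ω) | sampledHistory U σ n] =ᵐ[Pr]
      fun ω => ∫ r, h r ∂(P (σ n ω)) :=
  condExp_comp_of_condLaw (hU.sampledHistory_le n) (hU.measurable_replacement n)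
    (P.measurable.comp (measurable_color_sampledHistory n))
    (fun ω => (prob_le_one : P (σ n ω) Set.univ ≤ 1))
    (hU.replacement_law n) hh hint

lemma lintegral_net_sq_le (hU : IsUrnScheme P Pr U σ R) (n : ℕ) :
    ∫⁻ ω, ENNReal.ofReal ((R (n + 1) ω).net ^ 2) ∂Pr ≤
      ⨆ s, ∫⁻ r, ENNReal.ofReal (r.net ^ 2) ∂(P s) := by
  rw [hU.lintegral_replacement n
    (h := fun r => ENNReal.ofReal (r.net ^ 2))
    (Replacement.measurable_net.pow_const 2).ennreal_ofReal]
  calc _ ≤ ∫⁻ _, (⨆ s, ∫⁻ r, ENNReal.ofReal (r.net ^ 2) ∂(P s)) ∂Pr :=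
        lintegral_mono fun ω => le_iSup (fun s => ∫⁻ r, ENNReal.ofReal (r.net ^ 2) ∂(P s)) (σ n ω)
    _ = _ := by simp

lemma ae_net_nonneg (hU : IsUrnScheme P Pr U σ R) (hP : ∀ s, ∀ᵐ r ∂(P s), 0 ≤ r.net) (n : ℕ) :
    ∀ᵐ ω ∂Pr, 0 ≤ (R (n + 1) ω).net := by
  have hD : MeasurableSet {r : Replacement S | r.net < 0} :=
    measurableSet_lt Replacement.measurable_net measurable_const
  have h1 := hU.lintegral_replacement n (h := {r : Replacement S | r.net < 0}.indicator 1)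
    (measurable_one.indicator hD)
  have h2 : ∀ s, ∫⁻ r, {r : Replacement S | r.net < 0}.indicator 1 r ∂(P s) = 0 := by
    intro s
    rw [lintegral_indicator_one hD]
    simpa [ae_iff] using hP s
  simp only [h2, lintegral_zero] at h1
  rw [lintegral_eq_zero_iff
    (f := fun ω => {r : Replacement S | r.net < 0}.indicator 1 (R (n + 1) ω))
    ((measurable_one.indicator hD).comp (hU.measurable_replacement n))] at h1
  filter_upwards [h1] with ω h
  by_contra hlt
  have : R (n + 1) ω ∈ {r : Replacement S | r.net < 0} := not_le.1 hlt
  simp [Set.indicator_of_mem this] at h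

/-- A nonzero counting measure has integer mass at least 1, and net increments are almost surely
nonnegative. -/
lemma ae_one_le_total (hU : IsUrnScheme P Pr U σ R) (hP : ∀ s, ∀ᵐ r ∂(P s), 0 ≤ r.net) :
    ∀ᵐ ω ∂Pr, ∀ n, 1 ≤ ∫ _, (1 : ℝ) ∂(U n ω).1 := by
  filter_upwards [hU.init, ae_all_iff.2 fun n => hU.integral_step n (boundedMeasurable_const 1),
    ae_all_iff.2 (hU.ae_net_nonneg hP)] with ω h0 hs hn n
  induction n with
  | zero => exact CountingMeasure.one_le_integral_one h0
  | succ n ih =>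
    have h1 := hs n
    have h2 := hn n
    unfold Replacement.net at h2
    linarith

/-- The fluctuations of `U_n(f)` around its predictable drift average out. -/
lemma ae_tendsto_average_noise (hU : IsUrnScheme P Pr U σ R) {c : ℝ}
    (hC : ∀ s, ∫ r, r.copies ∂(P s) = c)
    (hsq : (⨆ s, ∫⁻ r, ENNReal.ofReal (r.net ^ 2) ∂(P s)) < ⊤)
    {f g : S → ℝ} (hf : BoundedMeasurable f) (hg : BoundedMeasurable g)
    (hfg : ∀ s, ∫ r, r.innov f ∂(P s) = g s) :
    ∀ᵐ ω ∂Pr, Tendsto (fun n : ℕ => (n : ℝ)⁻¹ * ∑ k ∈ Finset.range n,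
      (∫ s, f s ∂(U (k + 1) ω).1 - ∫ s, f s ∂(U k ω).1 -
        ∫ s, (c * f s + 1 * g s) ∂(normalized (U k ω).1))) atTop (𝓝 0) := by
  -- The mean increment of U_n(f) once the sampled color is s.
  set b : S → ℝ := fun s => c * f s + 1 * g s with hb
  have hbm : BoundedMeasurable b := hf.linear_combination hg c 1
  obtain ⟨K, hK⟩ := hf.2
  obtain ⟨L, hL⟩ := hbm.2
  have hKa : ∀ s, |f s| ≤ |K| := fun s => (hK s).trans (le_abs_self K)
  -- One |K| for f(σ_n) C, one for ξ(f), and |L| for the compensator.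
  set H : ℝ := 2 * |K| + |L| with hH
  have hRsq : ∀ n, ∫⁻ ω, ENNReal.ofReal ((R (n + 1) ω).net ^ 2) ∂Pr < ⊤ := fun n =>
    (hU.lintegral_net_sq_le n).trans_lt hsq
  have hnet := fun n => Replacement.memLp_net (hU.measurable_replacement n) (hRsq n)
  have hcop := fun n => Replacement.memLp_copies (hU.measurable_replacement n) (hRsq n)
  have hinn := fun n => Replacement.memLp_innov (hU.measurable_replacement n) (hRsq n) hf
  have hfσ : ∀ n, Measurable[sampledHistory U σ n] fun ω => f (σ n ω) := fun n =>
    hf.1.comp (measurable_color_sampledHistory n)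
  set Y : ℕ → Ω → ℝ := fun n ω => f (σ n ω) * (R (n + 1) ω).copies + (R (n + 1) ω).innov f with hY
  set V : ℕ → Ω → ℝ := fun n ω => ∫ s, b s ∂(normalized (U n ω).1) with hV
  have hfC : ∀ n, Integrable (fun ω => f (σ n ω) * (R (n + 1) ω).copies) Pr := fun n =>
    ((hcop n).integrable one_le_two).bdd_mul
      (hf.1.comp (hU.measurable_color n)).aestronglyMeasurable (ae_of_all _ fun ω => hK (σ n ω))
  have hYint : ∀ n, Integrable (Y n) Pr := fun n =>
    (hfC n).add ((hinn n).integrable one_le_two)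
  have hbσ : ∀ n, Integrable (fun ω => b (σ n ω)) Pr := fun n =>
    Integrable.of_bound (hbm.1.comp (hU.measurable_color n)).aestronglyMeasurable L
      (ae_of_all _ fun ω => hL _)
  have hYG : ∀ n, Pr[Y n | sampledHistory U σ n] =ᵐ[Pr] fun ω => b (σ n ω) := by
    intro n
    have h1 := condExp_add (hfC n) ((hinn n).integrable one_le_two) (sampledHistory U σ n)
    have h2 := condExp_mul_of_stronglyMeasurable_left (hfσ n).stronglyMeasurable (hfC n)
      ((hcop n).integrable one_le_two)
    have h3 := hU.condExp_replacement n Replacement.measurable_copies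
      ((hcop n).integrable one_le_two)
    have h4 := hU.condExp_replacement n (Replacement.measurable_innov hf.1)
      ((hinn n).integrable one_le_two)
    refine EventuallyEq.trans h1 ?_
    filter_upwards [h2, h3, h4] with ω e2 e3 e4
    refine (congrArg₂ (· + ·) e2 e4).trans ?_
    rw [Pi.mul_apply, e3, hfg, hC]
    simp only [hb]
    ring
  -- Tower property: average over the replacement given the color, then over the color.
  have hYF : ∀ n, Pr[Y n | urnHistory U n] =ᵐ[Pr] V n := by
    intro n
    have h1 : Pr[Pr[Y n | sampledHistory U σ n] | urnHistory U n] =ᵐ[Pr] Pr[Y n | urnHistory U n] :=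
      condExp_condExp_of_le le_sup_left (hU.sampledHistory_le n)
    exact h1.symm.trans ((condExp_congr_ae (hYG n)).trans (hU.condExp_color n hbm))
  have hVm : ∀ n, StronglyMeasurable[urnHistory U n] (V n) := by
    intro n
    have h1 : Measurable fun ν : CountingMeasure S => ∫ s, b s ∂(normalized ν.1) := by
      simp_rw [integral_normalized]
      exact (CountingMeasure.measurable_integral hbm.1).div
        (CountingMeasure.measurable_integral measurable_const)
    exact (h1.comp (measurable_urn_urnHistory le_rfl)).stronglyMeasurable
  have hVb : ∀ n ω, |V n ω| ≤ |L| := by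
    intro n ω
    have h1 := norm_integral_le_of_norm_le_const (μ := normalized (U n ω).1) (f := b)
      (ae_of_all _ fun s => (hL s).trans (le_abs_self L))
    refine h1.trans (mul_le_of_le_one_right (abs_nonneg L) ?_)
    exact ENNReal.toReal_le_of_le_ofReal zero_le_one (by simpa using normalized_univ_le_one _)
  set e : ℕ → Ω → ℝ := fun n ω =>
    ∫ s, f s ∂(U (n + 1) ω).1 - ∫ s, f s ∂(U n ω).1 - V n ω with he
  have heY : ∀ n, e n =ᵐ[Pr] Y n - V n := by
    intro n
    filter_upwards [hU.integral_step n hf] with ω h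
    simp only [he, hY, Pi.sub_apply, h]
  have hem : ∀ n, StronglyMeasurable[urnHistory U (n + 1)] (e n) := by
    intro n
    have h1 := CountingMeasure.measurable_integral hf.1
    have h2 : Measurable[urnHistory U (n + 1)] fun ω => ∫ s, f s ∂(U (n + 1) ω).1 :=
      h1.comp (measurable_urn_urnHistory le_rfl)
    have h3 : Measurable[urnHistory U (n + 1)] fun ω => ∫ s, f s ∂(U n ω).1 :=
      h1.comp (measurable_urn_urnHistory n.le_succ)
    refine (h2.sub h3).stronglyMeasurable.sub ((hVm n).mono ?_)
    exact (urnFiltration hU.measurable_urn).mono n.le_succ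
  have hem' : ∀ n, AEStronglyMeasurable (e n) Pr := fun n =>
    ((hem n).mono (hU.urnHistory_le _)).aestronglyMeasurable
  have hVint : ∀ n, Integrable (V n) Pr := fun n =>
    Integrable.of_bound ((hVm n).mono (hU.urnHistory_le n)).aestronglyMeasurable |L|
      (ae_of_all _ (hVb n))
  have hebound : ∀ n, ∀ᵐ ω ∂Pr, |e n ω| ≤ H * (|(R (n + 1) ω).net| + 1) := by
    intro n
    filter_upwards [heY n] with ω h
    rw [h, Pi.sub_apply]
    have h1 := (R (n + 1) ω).abs_copies_le
    have h2 := (R (n + 1) ω).abs_innov_le (abs_nonneg K) hKa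
    have h3 : |f (σ n ω) * (R (n + 1) ω).copies| ≤ |K| * (|(R (n + 1) ω).net| + 1) := by
      rw [abs_mul]
      exact mul_le_mul (hKa _) h1 (abs_nonneg _) (abs_nonneg _)
    have h4 := abs_sub (Y n ω) (V n ω)
    have h5 : |Y n ω| ≤ _ := abs_add_le _ _
    have h6 := hVb n ω
    have h7 : 0 ≤ |L| * |(R (n + 1) ω).net| := by positivity
    rw [hH]
    linarith
  have hdom : ∀ n, MemLp (fun ω => H * (|(R (n + 1) ω).net| + 1)) 2 Pr := fun n =>
    ((hnet n).norm.add (memLp_const 1)).const_mul H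
  have heL2 : ∀ n, MemLp (e n) 2 Pr := fun n =>
    (hdom n).mono (hem' n) ((hebound n).mono fun ω h => h.trans (le_abs_self _))
  set B : ℝ := (⨆ s, ∫⁻ r, ENNReal.ofReal (r.net ^ 2) ∂(P s)).toReal with hB
  -- The constant comes from (x + 1)² ≤ 2(x² + 1).
  refine ae_tendsto_average_of_martingale_difference (ℱ := urnFiltration hU.measurable_urn)
    (e := e) (B := 2 * H ^ 2 * (B + 1)) hem heL2 ?_ ?_
  · intro n
    have h1 : ∫ ω, (R (n + 1) ω).net ^ 2 ∂Pr ≤ B := by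
      rw [integral_eq_lintegral_of_nonneg_ae (ae_of_all _ fun ω => sq_nonneg _)
        (hnet n).integrable_sq.aestronglyMeasurable]
      exact ENNReal.toReal_mono hsq.ne (hU.lintegral_net_sq_le n)
    have hi : Integrable (fun ω => 2 * H ^ 2 * ((R (n + 1) ω).net ^ 2 + 1)) Pr :=
      ((hnet n).integrable_sq.add (integrable_const 1)).const_mul _
    calc ∫ ω, e n ω ^ 2 ∂Pr ≤ ∫ ω, 2 * H ^ 2 * ((R (n + 1) ω).net ^ 2 + 1) ∂Pr := by
          refine integral_mono_ae (heL2 n).integrable_sq hi ?_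
          filter_upwards [hebound n] with ω h
          have h2 : e n ω ^ 2 ≤ (H * (|(R (n + 1) ω).net| + 1)) ^ 2 := by
            rw [← sq_abs (e n ω)]
            exact pow_le_pow_left₀ (abs_nonneg _) h 2
          refine h2.trans ?_
          rw [← sq_abs ((R (n + 1) ω).net)]
          nlinarith [mul_nonneg (sq_nonneg H) (sq_nonneg (|(R (n + 1) ω).net| - 1))]
      _ = 2 * H ^ 2 * (∫ ω, (R (n + 1) ω).net ^ 2 ∂Pr + 1) := by
          rw [integral_const_mul, integral_add (hnet n).integrable_sq (integrable_const 1)]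
          simp
      _ ≤ 2 * H ^ 2 * (B + 1) := by gcongr
  · intro n
    refine (condExp_congr_ae (heY n)).trans ((condExp_sub (hYint n) (hVint n) _).trans ?_)
    have h1 : Pr[V n | urnHistory U n] = V n :=
      condExp_of_stronglyMeasurable (hU.urnHistory_le n) (hVm n) (hVint n)
    filter_upwards [hYF n] with ω h
    change (Pr[Y n | urnHistory U n]) ω - (Pr[V n | urnHistory U n]) ω = 0
    rw [h, h1, sub_self]

end IsUrnScheme

/-! ### Linear growth from increments -/

/-- A sequence whose increments are at least `r` up to a perturbation that averages out grows
at least at the linear rate `r`. -/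
lemma eventually_mul_le_of_increment_ge {T b e : ℕ → ℝ} {r r' : ℝ} (hr : r' < r)
    (hT : ∀ n, T (n + 1) = T n + b n + e n) (hb : ∀ n, r ≤ b n)
    (he : Tendsto (fun n : ℕ => (n : ℝ)⁻¹ * ∑ k ∈ Finset.range n, e k) atTop (𝓝 0)) :
    ∀ᶠ n : ℕ in atTop, r' * n ≤ T n := by
  have h1 : ∀ n : ℕ, T 0 + r * n + ∑ k ∈ Finset.range n, e k ≤ T n := by
    intro n
    induction n with
    | zero => simp
    | succ n ih =>
      rw [Finset.sum_range_succ, hT]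
      push_cast
      linarith [hb n]
  have h2 : Tendsto (fun n : ℕ => (n : ℝ)⁻¹ * T 0 + r + (n : ℝ)⁻¹ * ∑ k ∈ Finset.range n, e k)
      atTop (𝓝 (0 * T 0 + r + 0)) :=
    ((tendsto_inv_atTop_nhds_zero_nat.mul_const _).add_const r).add he
  rw [zero_mul, zero_add, add_zero] at h2
  filter_upwards [h2.eventually_const_lt hr, eventually_gt_atTop 0] with n h3 h4
  have hn : (0 : ℝ) < n := by exact_mod_cast h4
  refine le_trans ?_ (h1 n)
  have h5 := mul_le_mul_of_nonneg_right h3.le hn.le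
  refine h5.trans_eq ?_
  field_simp

lemma tendsto_average_of_increment {T b e : ℕ → ℝ} {l : ℝ}
    (hT : ∀ n, T (n + 1) = T n + b n + e n) (hb : Tendsto b atTop (𝓝 l))
    (he : Tendsto (fun n : ℕ => (n : ℝ)⁻¹ * ∑ k ∈ Finset.range n, e k) atTop (𝓝 0)) :
    Tendsto (fun n : ℕ => (n : ℝ)⁻¹ * T n) atTop (𝓝 l) := by
  have h1 : ∀ n : ℕ, T n = T 0 + ∑ k ∈ Finset.range n, b k + ∑ k ∈ Finset.range n, e k := by
    intro n
    induction n with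
    | zero => simp
    | succ n ih => rw [Finset.sum_range_succ, Finset.sum_range_succ, hT, ih]; ring
  have h2 := ((tendsto_inv_atTop_nhds_zero_nat (𝕜 := ℝ)).mul_const (T 0)).add (hb.cesaro.add he)
  rw [zero_mul, zero_add, add_zero] at h2
  refine h2.congr fun n => ?_
  rw [h1 n]
  ring

/-! ### The limit theorem -/

theorem theorem1 {S : Type*} [MeasurableSpace S] [StandardBorelSpace S]
    (P : Kernel S (Replacement S)) [IsMarkovKernel P]
    -- the urn is never emptied
    (hP : ∀ s, ∀ᵐ r ∂(P s), 0 ≤ r.net)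
    -- the mean number of copies does not depend on the sampled color
    (lam2 : ℝ) (hC : ∀ s, ∫ r, r.copies ∂(P s) = lam2)
    -- the intensity of the innovation is proportional to `μ`
    (μ : Measure S) [IsFiniteMeasure μ] (hμ : μ ≠ 0)
    (a : S → ℝ) (ha : Measurable a) (ha_bdd : ∃ c K : ℝ, 0 < c ∧ ∀ s, c ≤ a s ∧ a s ≤ K)
    (hxi : ∀ s, ∀ f : S → ℝ, BoundedMeasurable f →
      ∫ r, r.innov f ∂(P s) = a s * ∫ x, f x ∂μ)
    -- uniform positivity and second moment bounds
    (hpos : 0 < (⨅ s, P s {r | 1 ≤ r.net}))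
    (hsq : (⨆ s, ∫⁻ r, ENNReal.ofReal (r.net ^ 2) ∂(P s)) < ⊤)
    {Ω : Type*} [MeasurableSpace Ω] (Pr : Measure Ω) [IsProbabilityMeasure Pr]
    (U : ℕ → Ω → CountingMeasure S) (σ : ℕ → Ω → S) (R : ℕ → Ω → Replacement S)
    (hU : IsUrnScheme P Pr U σ R)
    (f : S → ℝ) (hf : BoundedMeasurable f) :
    (∀ᵐ ω ∂Pr, Tendsto (fun n : ℕ => (n : ℝ)⁻¹ * ∫ x, f x ∂(U n ω).1) atTop
      (𝓝 ((lam2 + ∫ x, a x ∂μ) * ∫ x, f x ∂(normalized μ)))) ∧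
    (∀ᵐ ω ∂Pr, Tendsto (fun n : ℕ => ∫ x, f x ∂(normalized (U n ω).1)) atTop
      (𝓝 (∫ x, f x ∂(normalized μ)))) := by
  obtain ⟨c, K, hc, hcK⟩ := ha_bdd
  have ha_bm : BoundedMeasurable a :=
    ⟨ha, K, fun s => by rw [abs_of_pos (hc.trans_le (hcK s).1)]; exact (hcK s).2⟩
  have h1_bm : BoundedMeasurable fun _ : S => (1 : ℝ) := boundedMeasurable_const 1
  obtain ⟨s₀⟩ : Nonempty S := by
    by_contra h
    rw [not_nonempty_iff] at h
    exact hμ (Measure.eq_zero_of_isEmpty μ)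
  have hPsq : ∀ s, ∫⁻ r, ENNReal.ofReal (r.net ^ 2) ∂(P s) < ⊤ := fun s =>
    (le_iSup (fun s => ∫⁻ r, ENNReal.ofReal (r.net ^ 2) ∂(P s)) s).trans_lt hsq
  set m : ℝ := ∫ _, (1 : ℝ) ∂μ with hm
  have hm0 : 0 < m := by
    rw [hm, integral_const, smul_eq_mul, mul_one]
    exact ENNReal.toReal_pos (Measure.measure_univ_ne_zero.2 hμ) (measure_ne_top μ _)
  have hlam : -1 ≤ lam2 := by
    rw [← hC s₀]
    have h := integral_mono (μ := P s₀) (integrable_const (-1))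
      ((Replacement.memLp_copies measurable_id (hPsq s₀)).integrable one_le_two)
      fun r => r.neg_one_le_copies
    simpa using h
  set p : ℝ := (⨅ s, P s {r | 1 ≤ r.net}).toReal with hp
  have hple : ∀ s, (⨅ s, P s {r | 1 ≤ r.net}) ≤ P s {r | 1 ≤ r.net} := fun s => iInf_le _ s
  have hp0 : 0 < p :=
    ENNReal.toReal_pos hpos.ne' (ne_top_of_le_ne_top (measure_ne_top _ _) (hple s₀))
  -- Two lower bounds on the mean net increment: p by Markov's inequality, since the net is
  -- nonnegative, and λ₂ + c m from a ≥ c. The first gives positivity, the second exceeds λ₂.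
  have hdrift : ∀ s, max p (lam2 + c * m) ≤ lam2 + a s * m := by
    intro s
    refine max_le ?_ ?_
    · have hnet : Integrable (fun r : Replacement S => r.net) (P s) :=
        (Replacement.memLp_net measurable_id (hPsq s)).integrable one_le_two
      have h1 : ∫ r, r.net ∂(P s) = lam2 + a s * m := by
        unfold Replacement.net
        rw [integral_add (f := fun r : Replacement S => r.copies) (g := fun r => r.innov fun _ => 1)
          ((Replacement.memLp_copies measurable_id (hPsq s)).integrable one_le_two)
          ((Replacement.memLp_innov measurable_id (hPsq s) h1_bm).integrable one_le_two), hC,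
          hxi s _ h1_bm]
      have h2 := mul_meas_ge_le_integral_of_nonneg (hP s) hnet 1
      rw [one_mul, h1] at h2
      exact (ENNReal.toReal_mono (measure_ne_top _ _) (hple s)).trans h2
    · have := mul_le_mul_of_nonneg_right (hcK s).1 hm0.le
      linarith
  set r₀ : ℝ := max p (lam2 + c * m) with hr₀
  have hr₀0 : 0 < r₀ := hp0.trans_le (le_max_left _ _)
  have hr₀l : lam2 < r₀ := by
    have : 0 < c * m := by positivity
    exact (lt_add_of_pos_right _ this).trans_le (le_max_right _ _)
  -- The strict gap below r₀ absorbs the averaged noise, while r still exceeds both λ₂ and 0.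
  obtain ⟨r, hr1, hr2⟩ := exists_between (max_lt hr₀l hr₀0)
  have hrl : lam2 < r := (le_max_left _ _).trans_lt hr1
  have hr0 : 0 < r := (le_max_right _ _).trans_lt hr1
  have noise : ∀ h : S → ℝ, BoundedMeasurable h → ∀ᵐ ω ∂Pr,
      Tendsto (fun n : ℕ => (n : ℝ)⁻¹ * ∑ k ∈ Finset.range n,
        (∫ s, h s ∂(U (k + 1) ω).1 - ∫ s, h s ∂(U k ω).1 -
          ∫ s, (lam2 * h s + 1 * (a s * ∫ x, h x ∂μ)) ∂(normalized (U k ω).1))) atTop (𝓝 0) := by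
    intro h hh
    refine hU.ae_tendsto_average_noise hC hsq hh (g := fun s => a s * ∫ x, h x ∂μ) ?_
      fun s => hxi s h hh
    simpa [mul_comm] using ha_bm.linear_combination h1_bm (∫ x, h x ∂μ) 0
  have drift_eq : ∀ h : S → ℝ, BoundedMeasurable h → ∀ n ω,
      ∫ s, (lam2 * h s + 1 * (a s * ∫ x, h x ∂μ)) ∂(normalized (U n ω).1) =
        lam2 * ((∫ s, h s ∂(U n ω).1) / ∫ _, (1 : ℝ) ∂(U n ω).1) +
          ((∫ s, a s ∂(U n ω).1) / ∫ _, (1 : ℝ) ∂(U n ω).1) * ∫ x, h x ∂μ := by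
    intro h hh n ω
    simp_rw [one_mul]
    rw [integral_add ((hh.integrable _).const_mul _) ((ha_bm.integrable _).mul_const _),
      integral_const_mul, integral_mul_const, integral_normalized, integral_normalized]
  -- centered test functions
  have center : ∀ h : S → ℝ, BoundedMeasurable h →
      BoundedMeasurable (fun s => 1 * h s + (-((∫ x, h x ∂μ) / m)) * 1) := fun h hh =>
    hh.linear_combination h1_bm _ _
  have center_int : ∀ h : S → ℝ, BoundedMeasurable h → ∀ (ν : Measure S) [IsFiniteMeasure ν],
      ∫ s, (1 * h s + (-((∫ x, h x ∂μ) / m)) * 1) ∂ν =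
        ∫ s, h s ∂ν - (∫ x, h x ∂μ) / m * ∫ _, (1 : ℝ) ∂ν := by
    intro h hh ν _
    rw [integral_add ((hh.integrable ν).const_mul _) ((h1_bm.integrable ν).const_mul _),
      integral_const_mul, integral_const_mul]
    ring
  have growth : ∀ᵐ ω ∂Pr, ∀ᶠ n : ℕ in atTop, r * n ≤ ∫ _, (1 : ℝ) ∂(U n ω).1 := by
    filter_upwards [noise _ h1_bm, hU.ae_one_le_total hP] with ω hω hT1
    refine eventually_mul_le_of_increment_ge hr2 (fun n => ?_) ?_ hω
      (b := fun n => ∫ s, (lam2 * 1 + 1 * (a s * m)) ∂(normalized (U n ω).1))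
    · rw [hm]
      ring
    · intro n
      have hTn : 0 < ∫ _, (1 : ℝ) ∂(U n ω).1 := by linarith [hT1 n]
      rw [integral_normalized, le_div_iff₀ hTn, ← integral_const_mul]
      refine integral_mono ((h1_bm.integrable _).const_mul _)
        (((h1_bm.integrable _).const_mul _).add (((ha_bm.integrable _).mul_const _).const_mul _)) ?_
      intro s
      have := hdrift s
      simp only
      linarith
  -- Centering removes the μ(h) a term from the drift, so the recursion closes in one scalar
  -- unknown.
  have sublinear : ∀ h : S → ℝ, BoundedMeasurable h → ∀ᵐ ω ∂Pr,
      Tendsto (fun n : ℕ => (n : ℝ)⁻¹ * (∫ s, h s ∂(U n ω).1 -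
        (∫ x, h x ∂μ) / m * ∫ _, (1 : ℝ) ∂(U n ω).1)) atTop (𝓝 0) := by
    intro h hh
    filter_upwards [noise _ (center h hh), hU.ae_one_le_total hP, growth] with ω hω hT1 hT
    have hμ0 : ∫ x, (1 * h x + (-((∫ x, h x ∂μ) / m)) * 1) ∂μ = 0 := by
      rw [center_int h hh μ, ← hm]
      field_simp
      ring
    have := tendsto_div_zero_of_subcritical hlam hr0 hrl hT1 hT
      (D := fun n => ∫ s, (1 * h s + (-((∫ x, h x ∂μ) / m)) * 1) ∂(U n ω).1) (fun n => ?_) hω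
    · refine this.congr fun n => ?_
      rw [center_int h hh]
    · rw [drift_eq _ (center h hh), hμ0]
      ring
  have total : ∀ᵐ ω ∂Pr, Tendsto (fun n : ℕ => (n : ℝ)⁻¹ * ∫ _, (1 : ℝ) ∂(U n ω).1) atTop
      (𝓝 (lam2 + ∫ x, a x ∂μ)) := by
    filter_upwards [noise _ h1_bm, sublinear a ha_bm, hU.ae_one_le_total hP, growth]
      with ω hω ha0 hT1 hT
    -- Linear growth bounds n / U_n(1) by 1/r, turning o(n) into o(U_n(1)); hence the normalized
    -- urn's integral of a converges.
    have hq : Tendsto (fun n : ℕ => (n : ℝ) / (∫ _, (1 : ℝ) ∂(U n ω).1) * ((n : ℝ)⁻¹ *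
        (∫ s, a s ∂(U n ω).1 - (∫ x, a x ∂μ) / m * ∫ _, (1 : ℝ) ∂(U n ω).1))) atTop (𝓝 0) := by
      refine bdd_le_mul_tendsto_zero' (r⁻¹) ?_ ha0
      filter_upwards [hT] with n hn
      have hTn : 0 < ∫ _, (1 : ℝ) ∂(U n ω).1 := by linarith [hT1 n]
      rw [abs_of_nonneg (by positivity), div_le_iff₀ hTn, inv_mul_eq_div, le_div_iff₀ hr0]
      linarith
    have hfrac : Tendsto (fun n : ℕ => (∫ s, a s ∂(U n ω).1) / ∫ _, (1 : ℝ) ∂(U n ω).1) atTop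
        (𝓝 ((∫ x, a x ∂μ) / m)) := by
      have h2 := hq.add_const ((∫ x, a x ∂μ) / m)
      rw [zero_add] at h2
      refine h2.congr' ?_
      filter_upwards [eventually_gt_atTop 0] with n hn
      have hTn : ∫ _, (1 : ℝ) ∂(U n ω).1 ≠ 0 := by linarith [hT1 n]
      have hn' : (n : ℝ) ≠ 0 := by positivity
      field_simp
      ring
    refine tendsto_average_of_increment (fun n => ?_) ?_ hω
      (b := fun n => ∫ s, (lam2 * 1 + 1 * (a s * m)) ∂(normalized (U n ω).1))
    · rw [hm]
      ring
    · have h2 := (hfrac.mul_const m).const_add lam2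
      rw [div_mul_cancel₀ _ hm0.ne'] at h2
      refine h2.congr fun n => ?_
      rw [drift_eq _ h1_bm, div_self (by linarith [hT1 n]), mul_one]
  have hmain : ∀ᵐ ω ∂Pr, Tendsto (fun n : ℕ => (n : ℝ)⁻¹ * ∫ x, f x ∂(U n ω).1) atTop
      (𝓝 ((lam2 + ∫ x, a x ∂μ) * ∫ x, f x ∂(normalized μ))) := by
    filter_upwards [sublinear f hf, total] with ω h1 h2
    have h3 := h1.add (h2.mul_const ((∫ x, f x ∂μ) / m))
    rw [zero_add] at h3
    rw [integral_normalized]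
    refine h3.congr fun n => ?_
    ring
  refine ⟨hmain, ?_⟩
  filter_upwards [hmain, total, growth] with ω h1 h2 hT
  -- Positivity of λ₁ is read off a sample path: U_n(1)/n is eventually at least r > 0.
  have hl : 0 < lam2 + ∫ x, a x ∂μ := by
    refine hr0.trans_le (ge_of_tendsto h2 ?_)
    filter_upwards [hT, eventually_gt_atTop 0] with n h3 h4
    rwa [inv_mul_eq_div, le_div_iff₀ (by exact_mod_cast h4)]
  have h3 := h1.div h2 hl.ne'
  rw [mul_div_cancel_left₀ _ hl.ne'] at h3
  refine h3.congr' ?_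
  filter_upwards [eventually_gt_atTop 0] with n hn
  rw [integral_normalized]
  exact mul_div_mul_left _ _ (inv_ne_zero (by exact_mod_cast hn.ne'))
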